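/- For an integer $k\ge 0$ let the four-spoke pinwheel configuration be the set $W_k=S_1\cup S_2\cup S_3\cup S_4\subset\mathbb R^2$, where, with $h_j=j(k-j)/k^3$ for $j\in\{0,1,\dots,k-1\}$, \[ \begin{aligned} S_1&=\{(k+j,\,1-h_j) : 0\le j<k\}, & S_2&=\{(-(k+j),\,h_j-1) : 0\le j<k\},\\ S_3&=\{(h_j-1,\,k+j) : 0\le j<k\}, & S_4&=\{(1-h_j,\,-(k+j)) : 0\le j<k\} \end{aligned} \] (for $k=0$ all these sets are empty). The counterclockwise cyclic order of the spokes is $S_1\to S_3\to S_2\to S_4\to S_1$. A convex pentagon of a finite set $X\subset\mathbb R^2$ is a $5$-element subset of $X$ in convex position, i.e. none of its points lies in the convex hull of the other four. Then $W_k$ consists of exactly $n=4k$ points, no three of which are collinear. A $5$-element subset of $W_k$ is a convex pentagon if and only if there is a spoke that contains all five of its points, or that contains exactly four of them with the fifth in the next spoke counterclockwise, or that contains exactly three of them with the other two in the next spoke counterclockwise. The number of convex pentagons of $W_k$ is exactly $2\binom{2k}{5}$. -/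

import Mathlib

/-- The four spokes `S₁, S₂, S₃, S₄` (indexed here by `0, 1, 2, 3`) of the pinwheel
construction with parameter `k`. -/
noncomputable def pinwheelSpoke (k : ℕ) : Fin 4 → Finset (ℝ × ℝ)
  | 0 => (Finset.range k).image fun j : ℕ =>
      ((k : ℝ) + j, -((j : ℝ) * ((k : ℝ) - j) / (k : ℝ) ^ 3) + 1)
  | 1 => (Finset.range k).image fun j : ℕ =>
      (-((k : ℝ) + j), (j : ℝ) * ((k : ℝ) - j) / (k : ℝ) ^ 3 - 1)
  | 2 => (Finset.range k).image fun j : ℕ =>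
      ((j : ℝ) * ((k : ℝ) - j) / (k : ℝ) ^ 3 - 1, (k : ℝ) + j)
  | 3 => (Finset.range k).image fun j : ℕ =>
      (-((j : ℝ) * ((k : ℝ) - j) / (k : ℝ) ^ 3) + 1, -((k : ℝ) + j))

/-- The pinwheel configuration: the union of the four spokes. -/
noncomputable def pinwheel (k : ℕ) : Finset (ℝ × ℝ) :=
  Finset.univ.biUnion (pinwheelSpoke k)

/-- The index of the next spoke counterclockwise. The spokes `S₁, S₃, S₂, S₄` point to the
right, up, to the left and down, so the counterclockwise order is `S₁ → S₃ → S₂ → S₄ → S₁`. -/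
def nextSpoke : Fin 4 → Fin 4
  | 0 => 2
  | 2 => 1
  | 1 => 3
  | 3 => 0

/-- The next spoke counterclockwise is the image of a spoke under the counterclockwise
rotation by a right angle about the origin. -/
theorem pinwheelSpoke_nextSpoke (k : ℕ) (i : Fin 4) :
    pinwheelSpoke k (nextSpoke i) =
      (pinwheelSpoke k i).image fun p : ℝ × ℝ => (-p.2, p.1) := by
  have h : ∀ a b c d : ℝ, a = c → b = d → ((a, b) : ℝ × ℝ) = (c, d) := by
    rintro a b c d rfl rfl
    rfl
  fin_cases i <;> simp only [nextSpoke, pinwheelSpoke, Finset.image_image] <;>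
    refine Finset.image_congr fun j _ => h _ _ _ _ ?_ ?_ <;> dsimp only <;> ring

/-- No three distinct points of `S` lie on a common line. -/
def InGeneralPosition (S : Finset (ℝ × ℝ)) : Prop :=
  ∀ p ∈ S, ∀ q ∈ S, ∀ r ∈ S, p ≠ q → p ≠ r → q ≠ r → ¬ Collinear ℝ {p, q, r}

/-- `P` is the vertex set of a (strictly) convex pentagon: it consists of five points, none of
which lies in the convex hull of the others. -/
def IsConvexPentagon (P : Finset (ℝ × ℝ)) : Prop :=
  P.card = 5 ∧ ConvexIndependent ℝ (fun p : P => (p : ℝ × ℝ))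

open Classical in
/-- The number of convex pentagons with vertices in `S`. -/
noncomputable def numConvexPentagons (S : Finset (ℝ × ℝ)) : ℕ :=
  (S.powerset.filter IsConvexPentagon).card

/-! ### Orientation of triples in the plane -/

/-! The sign of `orient` on pinwheel points depends only on their spokes and on their order along a
spoke. Each spoke turns left going outwards (`orient_same_spoke`). It is so flat that each of its
outward chords has the next spoke on its left and the other two on its right (`orient_chord_next`,
`orient_chord_opposite`, `orient_chord_previous`). Points on three successive spokes turn left
(`orient_three_spokes`). No sign is zero, hence general position.

Three points on a spoke, or two together with one on the next spoke, exclude any vertex on the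
remaining two spokes, since otherwise a vertex would lie in a triangle of others. Counting five
points on four spokes then leaves only the splits 5+0, 4+1 and 3+2 between a spoke and its
successor. Conversely, the signs make every such set convex. The four spokes give `4 * (C(k,5) +
C(k,4) C(k,1) + C(k,3) C(k,2))` pentagons, and Vandermonde's identity finishes. -/

/-- Twice the signed area of the triangle `p q r`. -/
def orient (p q r : ℝ × ℝ) : ℝ :=
  (q.1 - p.1) * (r.2 - p.2) - (q.2 - p.2) * (r.1 - p.1)

theorem orient_rotate (p q r : ℝ × ℝ) : orient q r p = orient p q r := by
  unfold orient
  ring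

theorem orient_swap (p q r : ℝ × ℝ) : orient p r q = -orient p q r := by
  unfold orient
  ring

theorem orient_self_right (p q : ℝ × ℝ) : orient p q q = 0 := by
  unfold orient
  ring

theorem orient_self_ends (p q : ℝ × ℝ) : orient p q p = 0 := by
  simp [orient]

theorem orient_quarter_turn (p q r : ℝ × ℝ) :
    orient (-p.2, p.1) (-q.2, q.1) (-r.2, r.1) = orient p q r := by
  simp only [orient]
  ring

theorem orient_eq_zero_of_collinear {p q r : ℝ × ℝ} (h : Collinear ℝ {p, q, r}) :
    orient p q r = 0 := by
  obtain ⟨v, hv⟩ := (collinear_iff_of_mem (p₀ := p) (by simp)).1 h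
  obtain ⟨s, hs⟩ := hv q (by simp)
  obtain ⟨t, ht⟩ := hv r (by simp)
  subst hs ht
  simp only [orient, vadd_eq_add, Prod.fst_add, Prod.snd_add, Prod.smul_fst, Prod.smul_snd,
    smul_eq_mul]
  ring

/-- The barycentric coordinates of `p` are the ratios of the three signed areas to their sum. -/
theorem mem_convexHull_triple {a b c p : ℝ × ℝ} (hab : 0 < orient a b p)
    (hbc : 0 < orient b c p) (hca : 0 < orient c a p) : p ∈ convexHull ℝ {a, b, c} := by
  have hd : 0 < orient a b p + orient b c p + orient c a p := by positivity
  set d := orient a b p + orient b c p + orient c a p with hd_def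
  have hsum : orient b c p / d + orient c a p / d + orient a b p / d = 1 := by
    rw [← add_div, ← add_div, div_eq_one_iff_eq hd.ne', hd_def]
    ring
  have hp : p = (orient b c p / d) • a + (orient c a p / d) • b + (orient a b p / d) • c := by
    have h1 : p.1 * d = orient b c p * a.1 + orient c a p * b.1 + orient a b p * c.1 := by
      rw [hd_def]
      unfold orient
      ring
    have h2 : p.2 * d = orient b c p * a.2 + orient c a p * b.2 + orient a b p * c.2 := by
      rw [hd_def]
      unfold orient
      ring
    refine Prod.ext ?_ ?_ <;>
      simp only [Prod.fst_add, Prod.snd_add, Prod.smul_fst, Prod.smul_snd, smul_eq_mul] <;>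
      field_simp <;> linarith
  have hconv := convex_convexHull ℝ ({a, b, c} : Set (ℝ × ℝ))
  have hsub := subset_convexHull ℝ ({a, b, c} : Set (ℝ × ℝ))
  have := hconv.sum_mem (t := Finset.univ)
    (w := ![orient b c p / d, orient c a p / d, orient a b p / d]) (z := ![a, b, c])
    (by intro i _; fin_cases i <;> simp <;> positivity)
    (by simpa [Fin.sum_univ_three] using hsum)
    (by intro i _; fin_cases i <;> exact hsub (by simp))
  rw [hp]
  simpa [Fin.sum_univ_three] using this

/-! ### Orientation criteria for convex pentagons -/

theorem isConvexPentagon_iff {P : Finset (ℝ × ℝ)} :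
    IsConvexPentagon P ↔
      P.card = 5 ∧ ∀ x ∈ P, x ∉ convexHull ℝ ((P : Set (ℝ × ℝ)) \ {x}) :=
  and_congr_right fun _ =>
    convexIndependent_set_iff_notMem_convexHull_sdiff (s := (P : Set (ℝ × ℝ)))

/-- A convex pentagon has no vertex inside a triangle spanned by others. -/
theorem IsConvexPentagon.not_mem_triangle {P : Finset (ℝ × ℝ)} (h : IsConvexPentagon P)
    {a b c p : ℝ × ℝ} (ha : a ∈ P) (hb : b ∈ P) (hc : c ∈ P) (hp : p ∈ P)
    (hab : 0 < orient a b p) (hbc : 0 < orient b c p) (hca : 0 < orient c a p) : False := by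
  refine (isConvexPentagon_iff.1 h).2 p hp
    (convexHull_mono ?_ (mem_convexHull_triple hab hbc hca))
  rintro x (rfl | rfl | rfl)
  · refine ⟨ha, ?_⟩
    rintro rfl
    simp [orient_self_right] at hca
  · refine ⟨hb, ?_⟩
    rintro rfl
    simp [orient_self_ends] at hbc
  · refine ⟨hc, ?_⟩
    rintro rfl
    simp [orient_self_ends] at hca

/-- Five points form a convex pentagon if their triples, taken in order, are positively oriented
(the triple `1 2 4` is not needed). -/
theorem isConvexPentagon_of_orient_pos {P : Finset (ℝ × ℝ)} (hP : P.card = 5)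
    (v : Fin 5 → ℝ × ℝ) (hv : ∀ i, v i ∈ P)
    (h012 : 0 < orient (v 0) (v 1) (v 2))
    (h013 : 0 < orient (v 0) (v 1) (v 3))
    (h014 : 0 < orient (v 0) (v 1) (v 4))
    (h023 : 0 < orient (v 0) (v 2) (v 3))
    (h024 : 0 < orient (v 0) (v 2) (v 4))
    (h034 : 0 < orient (v 0) (v 3) (v 4))
    (h123 : 0 < orient (v 1) (v 2) (v 3))
    (h134 : 0 < orient (v 1) (v 3) (v 4))
    (h234 : 0 < orient (v 2) (v 3) (v 4)) :
    IsConvexPentagon P := by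
  unfold orient at *
  -- As a function of `v j`, this sum is affine and vanishes on the line through `v i` parallel to
  -- the diagonal from `v (i - 1)` to `v (i + 1)`. That line strictly separates `v i` from the hull
  -- of the others, whereas an edge line would also contain a neighbour. The triple `1 2 4` is
  -- avoidable because `124 + 014 = 024 + 012`.
  have key : ∀ i j, j ≠ i →
      0 < orient (v i) (v (i + 1)) (v j) + orient (v (i - 1)) (v i) (v j) := by
    intro i j hij
    unfold orient
    fin_cases i <;> fin_cases j <;>
      first
        | exact absurd rfl hij
        | (simp only [Fin.reduceFinMk, Fin.zero_eta, Fin.mk_one, Fin.isValue, Fin.reduceAdd,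
            Fin.reduceSub, zero_add, sub_self]
           linarith)
  have hinj : Function.Injective v := by
    intro i j hij
    by_contra hne
    have := key i j (Ne.symm hne)
    rw [hij] at this
    simp [orient_self_right, orient_self_ends] at this
  have himage : Finset.univ.image v = P := by
    refine Finset.eq_of_subset_of_card_le ?_ ?_
    · intro x hx
      obtain ⟨i, -, rfl⟩ := Finset.mem_image.1 hx
      exact hv i
    · rw [Finset.card_image_of_injective _ hinj, hP]
      simp
  refine isConvexPentagon_iff.2 ⟨hP, ?_⟩
  intro x hx hmem
  rw [← himage] at hx
  obtain ⟨i, -, rfl⟩ := Finset.mem_image.1 hx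
  have hconv : Convex ℝ {y : ℝ × ℝ |
      0 < orient (v i) (v (i + 1)) y + orient (v (i - 1)) (v i) y} := by
    intro y hy z hz s t hs ht hst
    simp only [Set.mem_ofPred_eq] at hy hz ⊢
    have heq : orient (v i) (v (i + 1)) (s • y + t • z)
        + orient (v (i - 1)) (v i) (s • y + t • z)
        = s * (orient (v i) (v (i + 1)) y + orient (v (i - 1)) (v i) y)
        + t * (orient (v i) (v (i + 1)) z + orient (v (i - 1)) (v i) z) := by
      obtain rfl : t = 1 - s := by linarith
      simp only [orient, Prod.fst_add, Prod.snd_add, Prod.smul_fst, Prod.smul_snd, smul_eq_mul]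
      ring
    rw [heq]
    rcases hs.eq_or_lt with rfl | hs
    · obtain rfl : t = 1 := by linarith
      simpa using hz
    · have := mul_pos hs hy
      have := mul_nonneg ht hz.le
      linarith
  have hself := convexHull_min (s := (P : Set (ℝ × ℝ)) \ {v i}) (by
    rintro y ⟨hy, hne⟩
    rw [← himage] at hy
    obtain ⟨j, -, rfl⟩ := Finset.mem_image.1 (Finset.mem_coe.1 hy)
    exact key i j fun hji => hne (by rw [hji]; rfl)) hconv hmem
  simp [orient_self_right, orient_self_ends] at hself

/-! ### The points of the pinwheel -/

/-- The `j`-th point of the spoke `i`. -/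
noncomputable def pinwheelPoint (k : ℕ) : Fin 4 → ℕ → ℝ × ℝ
  | 0 => fun j => ((k : ℝ) + j, -((j : ℝ) * ((k : ℝ) - j) / (k : ℝ) ^ 3) + 1)
  | 1 => fun j => (-((k : ℝ) + j), (j : ℝ) * ((k : ℝ) - j) / (k : ℝ) ^ 3 - 1)
  | 2 => fun j => ((j : ℝ) * ((k : ℝ) - j) / (k : ℝ) ^ 3 - 1, (k : ℝ) + j)
  | 3 => fun j => (-((j : ℝ) * ((k : ℝ) - j) / (k : ℝ) ^ 3) + 1, -((k : ℝ) + j))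

theorem pinwheelSpoke_eq_image (k : ℕ) (i : Fin 4) :
    pinwheelSpoke k i = (Finset.range k).image (pinwheelPoint k i) := by
  fin_cases i <;> rfl

theorem pinwheelPoint_nextSpoke (k : ℕ) (i : Fin 4) (j : ℕ) :
    pinwheelPoint k (nextSpoke i) j = (-(pinwheelPoint k i j).2, (pinwheelPoint k i j).1) := by
  fin_cases i <;> simp only [nextSpoke, pinwheelPoint] <;> refine Prod.ext ?_ ?_ <;>
    dsimp only <;> ring

/-- Since `nextSpoke` is a 4-cycle and the quarter turn preserves `orient`, this reduces sign
computations to spoke `0`. -/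
theorem nextSpoke_induction {p : Fin 4 → Prop} (h0 : p 0) (h : ∀ i, p i → p (nextSpoke i))
    (i : Fin 4) : p i := by
  have h2 : p 2 := h 0 h0
  have h1 : p 1 := h 2 h2
  have h3 : p 3 := h 1 h1
  fin_cases i <;> assumption

theorem nextSpoke_four (i : Fin 4) : nextSpoke (nextSpoke (nextSpoke (nextSpoke i))) = i := by
  revert i
  decide

/-! ### Signs of the orientations of pinwheel triples -/

theorem orient_pinwheelPoint_nextSpoke (k : ℕ) (a b c : Fin 4) (j l m : ℕ) :
    orient (pinwheelPoint k (nextSpoke a) j) (pinwheelPoint k (nextSpoke b) l)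
        (pinwheelPoint k (nextSpoke c) m) =
      orient (pinwheelPoint k a j) (pinwheelPoint k b l) (pinwheelPoint k c m) := by
  simp only [pinwheelPoint_nextSpoke k a, pinwheelPoint_nextSpoke k b,
    pinwheelPoint_nextSpoke k c, orient_quarter_turn]

/-- The dent of a spoke is at most a quarter. -/
theorem dent_mem_Icc {k j : ℕ} (hj : j < k) :
    0 ≤ (j : ℝ) * ((k : ℝ) - j) / (k : ℝ) ^ 3 ∧
      (j : ℝ) * ((k : ℝ) - j) / (k : ℝ) ^ 3 ≤ 1 / 4 := by
  have hk : (1 : ℝ) ≤ k := by exact_mod_cast (by omega : 1 ≤ k)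
  have hjk : (j : ℝ) ≤ k := by exact_mod_cast hj.le
  refine ⟨div_nonneg (mul_nonneg (by positivity) (by linarith)) (by positivity), ?_⟩
  rw [div_le_div_iff₀ (by positivity) (by norm_num)]
  -- The bound is `4 j (k - j) ≤ k ^ 2 ≤ k ^ 3`.
  have h1 : (k : ℝ) ^ 2 ≤ (k : ℝ) ^ 3 := pow_le_pow_right₀ hk (by norm_num)
  nlinarith [sq_nonneg ((k : ℝ) - 2 * j)]

/-- The slopes of the segments of a spoke are small. -/
theorem abs_slope_le {k j l : ℕ} (hjl : j < l) (hl : l < k) :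
    |((k : ℝ) - l - j) / (k : ℝ) ^ 3| * (4 * k) ≤ 1 := by
  have hk : (2 : ℝ) ≤ k := by exact_mod_cast (by omega : 2 ≤ k)
  have h1 : (1 : ℝ) ≤ l + j := by exact_mod_cast (by omega : 1 ≤ l + j)
  have h2 : (l : ℝ) + 1 ≤ k := by exact_mod_cast hl
  have h3 : (j : ℝ) + 1 ≤ l := by exact_mod_cast hjl
  have habs : |(k : ℝ) - l - j| ≤ k - 1 := by
    rw [abs_le]
    constructor <;> linarith
  rw [abs_div, abs_of_pos (by positivity : (0 : ℝ) < (k : ℝ) ^ 3), div_mul_eq_mul_div,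
    div_le_one (by positivity)]
  -- The difference of the two sides is `k * (k - 2) ^ 2`.
  have h4 : (k - 1) * (4 * (k : ℝ)) ≤ (k : ℝ) ^ 3 := by
    nlinarith [mul_nonneg (by linarith : (0 : ℝ) ≤ k) (sq_nonneg ((k : ℝ) - 2))]
  exact (mul_le_mul_of_nonneg_right habs (by positivity)).trans h4

/-- The dent is a concave quadratic in the index, so the first spoke lies on a convex parabola; the
orientation is a Vandermonde product divided by `k ^ 3`. -/
theorem orient_same_spoke {k : ℕ} (i : Fin 4) {j l m : ℕ} (hjl : j < l) (hlm : l < m)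
    (hm : m < k) :
    0 < orient (pinwheelPoint k i j) (pinwheelPoint k i l) (pinwheelPoint k i m) := by
  refine nextSpoke_induction (p := fun i =>
    0 < orient (pinwheelPoint k i j) (pinwheelPoint k i l) (pinwheelPoint k i m)) ?_ ?_ i
  · have hk : (0 : ℝ) < k := by exact_mod_cast (by omega : 0 < k)
    have h1 : (0 : ℝ) < l - j := sub_pos.2 (by exact_mod_cast hjl)
    have h2 : (0 : ℝ) < m - l := sub_pos.2 (by exact_mod_cast hlm)
    have heq : orient (pinwheelPoint k 0 j) (pinwheelPoint k 0 l) (pinwheelPoint k 0 m) =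
        (l - j) * (m - l) * (m - l + (l - j)) / (k : ℝ) ^ 3 := by
      simp only [orient, pinwheelPoint]
      ring
    rw [heq]
    positivity
  · intro i hi
    rwa [orient_pinwheelPoint_nextSpoke]

/-- Orientation of a chord of the first spoke with an arbitrary point. -/
theorem orient_chord (k j l : ℕ) (r : ℝ × ℝ) :
    orient (pinwheelPoint k 0 j) (pinwheelPoint k 0 l) r =
      (l - j) * ((r.2 + (j : ℝ) * ((k : ℝ) - j) / (k : ℝ) ^ 3 - 1) +
        ((k : ℝ) - l - j) / (k : ℝ) ^ 3 * (r.1 - k - j)) := by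
  simp only [orient, pinwheelPoint]
  ring

/-- This bounds the rise or fall of a chord's line over a horizontal distance `x`. Here `4 * k` is
an upper bound for the horizontal distances that occur, so the drift never exceeds `1`. -/
theorem abs_slope_mul_le {k j l : ℕ} (hjl : j < l) (hl : l < k) {x c : ℝ}
    (hx : |x| ≤ c * (4 * k)) : |((k : ℝ) - l - j) / (k : ℝ) ^ 3 * x| ≤ c := by
  have hk : (0 : ℝ) < 4 * k := by exact_mod_cast (by omega : 0 < 4 * k)
  have hc : 0 ≤ c := by
    by_contra hc
    have := mul_neg_of_neg_of_pos (not_le.1 hc) hk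
    linarith [abs_nonneg x]
  rw [abs_mul]
  calc _ ≤ |((k : ℝ) - l - j) / (k : ℝ) ^ 3| * (c * (4 * k)) := by gcongr
    _ = c * (|((k : ℝ) - l - j) / (k : ℝ) ^ 3| * (4 * k)) := by ring
    _ ≤ c * 1 := by gcongr; exact abs_slope_le hjl hl
    _ = c := mul_one c

theorem orient_chord_next {k : ℕ} (i : Fin 4) {j l m : ℕ} (hjl : j < l) (hl : l < k)
    (hm : m < k) :
    0 < orient (pinwheelPoint k i j) (pinwheelPoint k i l)
      (pinwheelPoint k (nextSpoke i) m) := by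
  refine nextSpoke_induction (p := fun i => 0 < orient (pinwheelPoint k i j)
    (pinwheelPoint k i l) (pinwheelPoint k (nextSpoke i) m)) ?_ ?_ i
  · have hk : (2 : ℝ) ≤ k := by exact_mod_cast (by omega : 2 ≤ k)
    have hj0 : (0 : ℝ) ≤ j := by positivity
    have hm0 : (0 : ℝ) ≤ m := by positivity
    have hjk : (j : ℝ) + 1 ≤ k := by exact_mod_cast (by omega : j + 1 ≤ k)
    have h1 : (0 : ℝ) < l - j := sub_pos.2 (by exact_mod_cast hjl)
    have hdj := dent_mem_Icc (hjl.trans hl)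
    have hdm := dent_mem_Icc hm
    rw [orient_chord]
    refine mul_pos h1 ?_
    simp only [nextSpoke, pinwheelPoint]
    -- The horizontal distance is at most `2 * k`, so the drift is at most `1 / 2`, while the height
    -- difference is at least `k - 1 ≥ 1`.
    have hs := abs_le.1 (abs_slope_mul_le hjl hl (c := 1 / 2)
      (x := (m : ℝ) * ((k : ℝ) - m) / (k : ℝ) ^ 3 - 1 - k - j)
      (abs_le.2 ⟨by linarith, by linarith⟩))
    linarith [hs.1]
  · intro i hi
    rwa [orient_pinwheelPoint_nextSpoke]

theorem orient_chord_opposite {k : ℕ} (i : Fin 4) {j l m : ℕ} (hjl : j < l) (hl : l < k)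
    (hm : m < k) :
    orient (pinwheelPoint k i j) (pinwheelPoint k i l)
      (pinwheelPoint k (nextSpoke (nextSpoke i)) m) < 0 := by
  refine nextSpoke_induction (p := fun i => orient (pinwheelPoint k i j)
    (pinwheelPoint k i l) (pinwheelPoint k (nextSpoke (nextSpoke i)) m) < 0) ?_ ?_ i
  · have hk : (2 : ℝ) ≤ k := by exact_mod_cast (by omega : 2 ≤ k)
    have hj0 : (0 : ℝ) ≤ j := by positivity
    have hm0 : (0 : ℝ) ≤ m := by positivity
    have hjk : (j : ℝ) + 1 ≤ k := by exact_mod_cast (by omega : j + 1 ≤ k)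
    have hmk : (m : ℝ) + 1 ≤ k := by exact_mod_cast hm
    have h1 : (0 : ℝ) < l - j := sub_pos.2 (by exact_mod_cast hjl)
    have hdj := dent_mem_Icc (hjl.trans hl)
    have hdm := dent_mem_Icc hm
    rw [orient_chord]
    refine mul_neg_of_pos_of_neg h1 ?_
    simp only [nextSpoke, pinwheelPoint]
    -- This is the tightest case: the two dents total at most `1 / 2`, so the point is at least `3 /
    -- 2` lower, against a drift of at most `1`.
    have hs := abs_le.1 (abs_slope_mul_le hjl hl (c := 1)
      (x := -((k : ℝ) + m) - k - j) (abs_le.2 ⟨by linarith, by linarith⟩))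
    linarith [hs.2]
  · intro i hi
    rwa [orient_pinwheelPoint_nextSpoke]

theorem orient_chord_previous {k : ℕ} (i : Fin 4) {j l m : ℕ} (hjl : j < l) (hl : l < k)
    (hm : m < k) :
    orient (pinwheelPoint k i j) (pinwheelPoint k i l)
      (pinwheelPoint k (nextSpoke (nextSpoke (nextSpoke i))) m) < 0 := by
  refine nextSpoke_induction (p := fun i => orient (pinwheelPoint k i j)
    (pinwheelPoint k i l) (pinwheelPoint k (nextSpoke (nextSpoke (nextSpoke i))) m) < 0) ?_ ?_ i
  · have hk : (2 : ℝ) ≤ k := by exact_mod_cast (by omega : 2 ≤ k)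
    have hj0 : (0 : ℝ) ≤ j := by positivity
    have hm0 : (0 : ℝ) ≤ m := by positivity
    have hjk : (j : ℝ) + 1 ≤ k := by exact_mod_cast (by omega : j + 1 ≤ k)
    have h1 : (0 : ℝ) < l - j := sub_pos.2 (by exact_mod_cast hjl)
    have hdj := dent_mem_Icc (hjl.trans hl)
    have hdm := dent_mem_Icc hm
    rw [orient_chord]
    refine mul_neg_of_pos_of_neg h1 ?_
    simp only [nextSpoke, pinwheelPoint]
    have hs := abs_le.1 (abs_slope_mul_le hjl hl (c := 1 / 2)
      (x := -((m : ℝ) * ((k : ℝ) - m) / (k : ℝ) ^ 3) + 1 - k - j)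
      (abs_le.2 ⟨by linarith, by linarith⟩))
    linarith [hs.2]
  · intro i hi
    rwa [orient_pinwheelPoint_nextSpoke]

theorem orient_three_spokes {k : ℕ} (i : Fin 4) {j l m : ℕ} (hj : j < k) (hl : l < k)
    (hm : m < k) :
    0 < orient (pinwheelPoint k i j) (pinwheelPoint k (nextSpoke i) l)
      (pinwheelPoint k (nextSpoke (nextSpoke i)) m) := by
  refine nextSpoke_induction (p := fun i => 0 < orient (pinwheelPoint k i j)
    (pinwheelPoint k (nextSpoke i) l) (pinwheelPoint k (nextSpoke (nextSpoke i)) m)) ?_ ?_ i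
  · have hk : (1 : ℝ) ≤ k := by exact_mod_cast (by omega : 1 ≤ k)
    have hj0 : (0 : ℝ) ≤ j := by positivity
    have hl0 : (0 : ℝ) ≤ l := by positivity
    have hm0 : (0 : ℝ) ≤ m := by positivity
    have hdj := dent_mem_Icc hj
    have hdl := dent_mem_Icc hl
    have hdm := dent_mem_Icc hm
    simp only [orient, nextSpoke, pinwheelPoint]
    set a := (j : ℝ) * ((k : ℝ) - j) / (k : ℝ) ^ 3
    set b := (l : ℝ) * ((k : ℝ) - l) / (k : ℝ) ^ 3
    set c := (m : ℝ) * ((k : ℝ) - m) / (k : ℝ) ^ 3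
    -- The determinant is the sum of this product and the next; the second vanishes when `k = 1`, so
    -- strictness comes from the first.
    have h1 : 0 < (1 - b + (k + j)) * (1 - c + (1 - a)) :=
      mul_pos (by linarith) (by linarith)
    have h2 : 0 ≤ ((k : ℝ) + l - (1 - a)) * (k + m + (k + j)) :=
      mul_nonneg (by linarith) (by linarith)
    linarith
  · intro i hi
    rwa [orient_pinwheelPoint_nextSpoke]

/-! ### Cardinality and general position -/

theorem pinwheelPoint_injective (k : ℕ) (i : Fin 4) : Function.Injective (pinwheelPoint k i) := by
  refine nextSpoke_induction (p := fun i => Function.Injective (pinwheelPoint k i)) ?_ ?_ i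
  · intro j l h
    have := congrArg Prod.fst h
    simpa [pinwheelPoint] using this
  · intro i hi j l h
    refine hi (Prod.ext ?_ ?_) <;> simp only [pinwheelPoint_nextSpoke, Prod.mk.injEq, neg_inj] at h
    exacts [h.2, h.1]

/-- Each spoke lies in its own open quadrant, so the signs of the coordinates identify it. -/
theorem spoke_eq_of_pinwheelPoint_eq {k : ℕ} {a b : Fin 4} {j l : ℕ} (hj : j < k) (hl : l < k)
    (h : pinwheelPoint k a j = pinwheelPoint k b l) : a = b := by
  have hk : (1 : ℝ) ≤ k := by exact_mod_cast (by omega : 1 ≤ k)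
  have hj0 : (0 : ℝ) ≤ j := by positivity
  have hl0 : (0 : ℝ) ≤ l := by positivity
  have hdj := dent_mem_Icc hj
  have hdl := dent_mem_Icc hl
  have h1 := congrArg Prod.fst h
  have h2 := congrArg Prod.snd h
  clear h
  fin_cases a <;> fin_cases b <;> first | rfl | (simp only [pinwheelPoint] at h1 h2; linarith)

theorem mem_pinwheelSpoke {k : ℕ} {i : Fin 4} {p : ℝ × ℝ} :
    p ∈ pinwheelSpoke k i ↔ ∃ j < k, pinwheelPoint k i j = p := by
  simp [pinwheelSpoke_eq_image]

theorem mem_pinwheel {k : ℕ} {p : ℝ × ℝ} :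
    p ∈ pinwheel k ↔ ∃ i, p ∈ pinwheelSpoke k i := by
  simp [pinwheel]

theorem pinwheelSpoke_subset_pinwheel (k : ℕ) (i : Fin 4) : pinwheelSpoke k i ⊆ pinwheel k :=
  fun _ hp => mem_pinwheel.2 ⟨i, hp⟩

theorem disjoint_pinwheelSpoke (k : ℕ) {a b : Fin 4} (hab : a ≠ b) :
    Disjoint (pinwheelSpoke k a) (pinwheelSpoke k b) := by
  rw [Finset.disjoint_left]
  intro p ha hb
  obtain ⟨j, hj, rfl⟩ := mem_pinwheelSpoke.1 ha
  obtain ⟨l, hl, h⟩ := mem_pinwheelSpoke.1 hb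
  exact hab (spoke_eq_of_pinwheelPoint_eq hl hj h).symm

theorem card_pinwheelSpoke (k : ℕ) (i : Fin 4) : (pinwheelSpoke k i).card = k := by
  rw [pinwheelSpoke_eq_image, Finset.card_image_of_injective _ (pinwheelPoint_injective k i),
    Finset.card_range]

theorem card_pinwheel (k : ℕ) : (pinwheel k).card = 4 * k := by
  rw [pinwheel, Finset.card_biUnion fun a _ b _ hab => disjoint_pinwheelSpoke k hab]
  simp [card_pinwheelSpoke]

theorem orient_chord_ne_zero {k : ℕ} {a b : Fin 4} {j l m : ℕ} (hj : j < k) (hl : l < k)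
    (hm : m < k) (hjl : j ≠ l) (hab : a ≠ b) :
    orient (pinwheelPoint k a j) (pinwheelPoint k a l) (pinwheelPoint k b m) ≠ 0 := by
  wlog h : j < l generalizing j l
  · have := this hl hj hjl.symm (by omega)
    rw [← orient_rotate, orient_swap, neg_ne_zero] at this
    exact this
  have hb : ∀ a b : Fin 4, a ≠ b → b = nextSpoke a ∨ b = nextSpoke (nextSpoke a) ∨
      b = nextSpoke (nextSpoke (nextSpoke a)) := by decide
  rcases hb a b hab with rfl | rfl | rfl
  · exact (orient_chord_next a h hl hm).ne'
  · exact (orient_chord_opposite a h hl hm).ne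
  · exact (orient_chord_previous a h hl hm).ne

theorem orient_same_spoke_ne_zero {k : ℕ} (i : Fin 4) {j l m : ℕ} (hj : j < k) (hl : l < k)
    (hm : m < k) (hjl : j ≠ l) (hjm : j ≠ m) (hlm : l ≠ m) :
    orient (pinwheelPoint k i j) (pinwheelPoint k i l) (pinwheelPoint k i m) ≠ 0 := by
  have hperm : ∀ p q r : ℝ × ℝ, 0 < orient p q r → orient q r p ≠ 0 ∧ orient r p q ≠ 0 ∧
      orient p r q ≠ 0 ∧ orient r q p ≠ 0 ∧ orient q p r ≠ 0 := by
    intro p q r h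
    unfold orient at *
    refine ⟨?_, ?_, ?_, ?_, ?_⟩ <;> intro h' <;> linarith
  rcases hjl.lt_or_gt with h1 | h1 <;> rcases hjm.lt_or_gt with h2 | h2 <;>
    rcases hlm.lt_or_gt with h3 | h3
  · exact (orient_same_spoke i h1 h3 hm).ne'
  · exact (hperm _ _ _ (orient_same_spoke i h2 h3 hl)).2.2.1
  · omega
  · exact (hperm _ _ _ (orient_same_spoke i h2 h1 hl)).1
  · exact (hperm _ _ _ (orient_same_spoke i h1 h2 hm)).2.2.2.2
  · omega
  · exact (hperm _ _ _ (orient_same_spoke i h3 h2 hj)).2.1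
  · exact (hperm _ _ _ (orient_same_spoke i h3 h1 hj)).2.2.2.1

theorem orient_three_spokes_ne_zero {k : ℕ} {a b c : Fin 4} {j l m : ℕ} (hj : j < k) (hl : l < k)
    (hm : m < k) (hab : a ≠ b) (hac : a ≠ c) (hbc : b ≠ c) :
    orient (pinwheelPoint k a j) (pinwheelPoint k b l) (pinwheelPoint k c m) ≠ 0 := by
  have hperm : ∀ a b c : Fin 4, a ≠ b → a ≠ c → b ≠ c →
      (b = nextSpoke a ∧ c = nextSpoke (nextSpoke a)) ∨
      (c = nextSpoke b ∧ a = nextSpoke (nextSpoke b)) ∨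
      (a = nextSpoke c ∧ b = nextSpoke (nextSpoke c)) ∨
      (c = nextSpoke a ∧ b = nextSpoke (nextSpoke a)) ∨
      (a = nextSpoke b ∧ c = nextSpoke (nextSpoke b)) ∨
      (b = nextSpoke c ∧ a = nextSpoke (nextSpoke c)) := by decide
  rcases hperm a b c hab hac hbc with ⟨rfl, rfl⟩ | ⟨rfl, rfl⟩ | ⟨rfl, rfl⟩ | ⟨rfl, rfl⟩ |
    ⟨rfl, rfl⟩ | ⟨rfl, rfl⟩
  · exact (orient_three_spokes _ hj hl hm).ne'
  · have := orient_three_spokes b hl hm hj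
    rw [orient_rotate] at this
    exact this.ne'
  · have := orient_three_spokes c hm hj hl
    rw [← orient_rotate] at this
    exact this.ne'
  · have := orient_three_spokes a hj hm hl
    rw [orient_swap] at this
    linarith
  · have := orient_three_spokes b hl hj hm
    rw [← orient_rotate, orient_swap] at this
    linarith
  · have := orient_three_spokes c hm hl hj
    rw [orient_swap, ← orient_rotate] at this
    linarith

theorem inGeneralPosition_pinwheel (k : ℕ) : InGeneralPosition (pinwheel k) := by
  intro p hp q hq r hr hpq hpr hqr hcol
  have h0 := orient_eq_zero_of_collinear hcol
  obtain ⟨a, ha⟩ := mem_pinwheel.1 hp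
  obtain ⟨b, hb⟩ := mem_pinwheel.1 hq
  obtain ⟨c, hc⟩ := mem_pinwheel.1 hr
  obtain ⟨j, hj, rfl⟩ := mem_pinwheelSpoke.1 ha
  obtain ⟨l, hl, rfl⟩ := mem_pinwheelSpoke.1 hb
  obtain ⟨m, hm, rfl⟩ := mem_pinwheelSpoke.1 hc
  by_cases hab : a = b
  · subst hab
    have hjl : j ≠ l := fun h => hpq (by rw [h])
    by_cases hac : a = c
    · subst hac
      exact orient_same_spoke_ne_zero a hj hl hm hjl (fun h => hpr (by rw [h]))
        (fun h => hqr (by rw [h])) h0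
    · exact orient_chord_ne_zero hj hl hm hjl hac h0
  · by_cases hac : a = c
    · subst hac
      refine orient_chord_ne_zero hm hj hl (fun h => hpr (by rw [h])) hab ?_
      rw [← orient_rotate]
      exact h0
    · by_cases hbc : b = c
      · subst hbc
        refine orient_chord_ne_zero hl hm hj (fun h => hqr (by rw [h])) (Ne.symm hab) ?_
        rw [orient_rotate]
        exact h0
      · exact orient_three_spokes_ne_zero hj hl hm hab hac hbc h0

/-! ### Convex pentagons -/

/-- A subset of a spoke with at least `n` points contains `n` of them in increasing order. -/
theorem exists_strictMono_of_le_card_inter {k : ℕ} {i : Fin 4} {P : Finset (ℝ × ℝ)} {n : ℕ}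
    (h : n ≤ (P ∩ pinwheelSpoke k i).card) :
    ∃ f : Fin n → ℕ, StrictMono f ∧ ∀ a, f a < k ∧ pinwheelPoint k i (f a) ∈ P := by
  classical
  set J := (Finset.range k).filter fun j => pinwheelPoint k i j ∈ P
  have hJ : P ∩ pinwheelSpoke k i = J.image (pinwheelPoint k i) := by
    ext p
    simp only [Finset.mem_inter, mem_pinwheelSpoke, Finset.mem_image, J, Finset.mem_filter,
      Finset.mem_range]
    constructor
    · rintro ⟨hp, j, hj, rfl⟩
      exact ⟨j, ⟨hj, hp⟩, rfl⟩
    · rintro ⟨j, ⟨hj, hp⟩, rfl⟩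
      exact ⟨hp, j, hj, rfl⟩
  rw [hJ, Finset.card_image_of_injective _ (pinwheelPoint_injective k i)] at h
  obtain ⟨K, hKJ, hK⟩ := Finset.exists_subset_card_eq h
  refine ⟨K.orderEmbOfFin hK, (K.orderEmbOfFin hK).strictMono, fun a => ?_⟩
  have := hKJ (K.orderEmbOfFin_mem hK a)
  simpa [J] using this

theorem card_eq_sum_inter {k : ℕ} {P : Finset (ℝ × ℝ)} (hP : P ⊆ pinwheel k) (i : Fin 4) :
    P.card = (P ∩ pinwheelSpoke k i).card + (P ∩ pinwheelSpoke k (nextSpoke i)).card +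
      (P ∩ pinwheelSpoke k (nextSpoke (nextSpoke i))).card +
      (P ∩ pinwheelSpoke k (nextSpoke (nextSpoke (nextSpoke i)))).card := by
  have h : P.card = ∑ a, (P ∩ pinwheelSpoke k a).card := by
    rw [← Finset.card_biUnion fun a _ b _ hab => (disjoint_pinwheelSpoke k hab).mono
      Finset.inter_subset_right Finset.inter_subset_right, ← Finset.inter_biUnion]
    exact congrArg _ (Finset.inter_eq_left.2 hP).symm
  rw [h, Fin.sum_univ_four]
  refine nextSpoke_induction (p := fun i => _ = (P ∩ pinwheelSpoke k i).card +
    (P ∩ pinwheelSpoke k (nextSpoke i)).card +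
    (P ∩ pinwheelSpoke k (nextSpoke (nextSpoke i))).card +
    (P ∩ pinwheelSpoke k (nextSpoke (nextSpoke (nextSpoke i)))).card) ?_ ?_ i
  · simp only [nextSpoke]
    ring
  · intro i hi
    rw [nextSpoke_four]
    omega

/-! ### Distributions excluded by a vertex inside a triangle -/

section Necessity

variable {k : ℕ} {P : Finset (ℝ × ℝ)} {i : Fin 4}

/-- A point to the right of both successive chords of three spoke points forms, with the two outer
ones, a triangle containing the middle one. -/
theorem IsConvexPentagon.inter_opposite_eq_zero_of_three (h : IsConvexPentagon P)
    (h3 : 3 ≤ (P ∩ pinwheelSpoke k i).card) :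
    (P ∩ pinwheelSpoke k (nextSpoke (nextSpoke i))).card = 0 ∧
      (P ∩ pinwheelSpoke k (nextSpoke (nextSpoke (nextSpoke i)))).card = 0 := by
  obtain ⟨f, hf, hfP⟩ := exists_strictMono_of_le_card_inter h3
  have h01 : f 0 < f 1 := hf (by decide)
  have h12 : f 1 < f 2 := hf (by decide)
  have hpos := orient_same_spoke i h01 h12 (hfP 2).1
  have key : ∀ d ∈ P,
      orient (pinwheelPoint k i (f 0)) (pinwheelPoint k i (f 1)) d < 0 →
      orient (pinwheelPoint k i (f 1)) (pinwheelPoint k i (f 2)) d < 0 → False := by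
    intro d hd h1 h2
    refine h.not_mem_triangle (hfP 0).2 hd (hfP 2).2 (hfP 1).2 ?_ ?_ ?_
    · rw [orient_swap]
      linarith
    · rw [← orient_rotate, ← orient_rotate, orient_swap]
      linarith
    · rwa [← orient_rotate]
  constructor <;> rw [Finset.card_eq_zero, Finset.eq_empty_iff_forall_notMem] <;>
    intro d hd <;> obtain ⟨hdP, hds⟩ := Finset.mem_inter.1 hd <;>
    obtain ⟨m, hm, rfl⟩ := mem_pinwheelSpoke.1 hds
  · exact key _ hdP (orient_chord_opposite i h01 (hfP 1).1 hm)
      (orient_chord_opposite i h12 (hfP 2).1 hm)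
  · exact key _ hdP (orient_chord_previous i h01 (hfP 1).1 hm)
      (orient_chord_previous i h12 (hfP 2).1 hm)

/-- The inner of the two spoke points would lie in the triangle formed by the outer one, the point
of the next spoke and a point of either remaining spoke. -/
theorem IsConvexPentagon.inter_opposite_eq_zero_of_two (h : IsConvexPentagon P)
    (h2 : 2 ≤ (P ∩ pinwheelSpoke k i).card)
    (h1 : 1 ≤ (P ∩ pinwheelSpoke k (nextSpoke i)).card) :
    (P ∩ pinwheelSpoke k (nextSpoke (nextSpoke i))).card = 0 ∧
      (P ∩ pinwheelSpoke k (nextSpoke (nextSpoke (nextSpoke i)))).card = 0 := by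
  obtain ⟨f, hf, hfP⟩ := exists_strictMono_of_le_card_inter h2
  obtain ⟨g, -, hgP⟩ := exists_strictMono_of_le_card_inter h1
  have h01 : f 0 < f 1 := hf (by decide)
  have hpos := orient_chord_next i h01 (hfP 1).1 (hgP 0).1
  have key : ∀ d ∈ P,
      orient (pinwheelPoint k i (f 0)) (pinwheelPoint k i (f 1)) d < 0 →
      0 < orient (pinwheelPoint k i (f 0)) (pinwheelPoint k (nextSpoke i) (g 0)) d → False := by
    intro d hd h1 h2
    refine h.not_mem_triangle (hfP 1).2 (hgP 0).2 hd (hfP 0).2 ?_ ?_ ?_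
    · rwa [orient_rotate]
    · rwa [orient_rotate]
    · rw [orient_rotate, orient_swap]
      linarith
  constructor <;> rw [Finset.card_eq_zero, Finset.eq_empty_iff_forall_notMem] <;>
    intro d hd <;> obtain ⟨hdP, hds⟩ := Finset.mem_inter.1 hd <;>
    obtain ⟨m, hm, rfl⟩ := mem_pinwheelSpoke.1 hds
  · exact key _ hdP (orient_chord_opposite i h01 (hfP 1).1 hm)
      (orient_three_spokes i (hfP 0).1 (hgP 0).1 hm)
  · refine key _ hdP (orient_chord_previous i h01 (hfP 1).1 hm) ?_
    have := orient_three_spokes (nextSpoke (nextSpoke (nextSpoke i))) hm (hfP 0).1 (hgP 0).1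
    rw [nextSpoke_four] at this
    rwa [orient_rotate]

end Necessity

/-! ### Convexity of the 5+0, 4+1 and 3+2 splits -/

section Sufficiency

variable {k : ℕ} {P : Finset (ℝ × ℝ)} {i : Fin 4}

theorem isConvexPentagon_of_five (h5 : P.card = 5)
    (hi : 5 ≤ (P ∩ pinwheelSpoke k i).card) : IsConvexPentagon P := by
  obtain ⟨f, hf, hfP⟩ := exists_strictMono_of_le_card_inter hi
  have hpos := fun {a b c} (hab : a < b) (hbc : b < c) =>
    orient_same_spoke i (hf hab) (hf hbc) (hfP c).1
  refine isConvexPentagon_of_orient_pos h5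
    ![pinwheelPoint k i (f 0),
      pinwheelPoint k i (f 1),
      pinwheelPoint k i (f 2),
      pinwheelPoint k i (f 3),
      pinwheelPoint k i (f 4)] ?_
    (hpos (by decide) (by decide))
    (hpos (by decide) (by decide))
    (hpos (by decide) (by decide))
    (hpos (by decide) (by decide))
    (hpos (by decide) (by decide))
    (hpos (by decide) (by decide))
    (hpos (by decide) (by decide))
    (hpos (by decide) (by decide))
    (hpos (by decide) (by decide))
  intro a
  fin_cases a
  exacts [(hfP 0).2, (hfP 1).2, (hfP 2).2, (hfP 3).2, (hfP 4).2]

theorem isConvexPentagon_of_four_one (h5 : P.card = 5)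
    (hi : 4 ≤ (P ∩ pinwheelSpoke k i).card)
    (hn : 1 ≤ (P ∩ pinwheelSpoke k (nextSpoke i)).card) : IsConvexPentagon P := by
  obtain ⟨f, hf, hfP⟩ := exists_strictMono_of_le_card_inter hi
  obtain ⟨g, -, hgP⟩ := exists_strictMono_of_le_card_inter hn
  have hpos := fun {a b c} (hab : a < b) (hbc : b < c) =>
    orient_same_spoke i (hf hab) (hf hbc) (hfP c).1
  have hnext := fun {a b} (hab : a < b) (c) =>
    orient_chord_next i (hf hab) (hfP b).1 (hgP c).1
  refine isConvexPentagon_of_orient_pos h5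
    ![pinwheelPoint k i (f 0),
      pinwheelPoint k i (f 1),
      pinwheelPoint k i (f 2),
      pinwheelPoint k i (f 3),
      pinwheelPoint k (nextSpoke i) (g 0)] ?_
    (hpos (by decide) (by decide))
    (hpos (by decide) (by decide))
    (hnext (by decide) 0)
    (hpos (by decide) (by decide))
    (hnext (by decide) 0)
    (hnext (by decide) 0)
    (hpos (by decide) (by decide))
    (hnext (by decide) 0)
    (hnext (by decide) 0)
  intro a
  fin_cases a
  exacts [(hfP 0).2, (hfP 1).2, (hfP 2).2, (hfP 3).2, (hgP 0).2]

theorem isConvexPentagon_of_three_two (h5 : P.card = 5)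
    (hi : 3 ≤ (P ∩ pinwheelSpoke k i).card)
    (hn : 2 ≤ (P ∩ pinwheelSpoke k (nextSpoke i)).card) : IsConvexPentagon P := by
  obtain ⟨f, hf, hfP⟩ := exists_strictMono_of_le_card_inter hi
  obtain ⟨g, hg, hgP⟩ := exists_strictMono_of_le_card_inter hn
  have hpos := fun {a b c} (hab : a < b) (hbc : b < c) =>
    orient_same_spoke i (hf hab) (hf hbc) (hfP c).1
  have hnext := fun {a b} (hab : a < b) (c) =>
    orient_chord_next i (hf hab) (hfP b).1 (hgP c).1
  -- The counterclockwise boundary runs outwards along spoke `i` and back inwards along the next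
  -- one, hence `g 1` before `g 0`.
  have hback : ∀ a, 0 < orient (pinwheelPoint k i (f a)) (pinwheelPoint k (nextSpoke i) (g 1))
      (pinwheelPoint k (nextSpoke i) (g 0)) := by
    intro a
    have := orient_chord_previous (nextSpoke i) (hg (by decide : (0 : Fin 2) < 1)) (hgP 1).1
      (hfP a).1
    rw [nextSpoke_four, orient_rotate] at this
    rw [orient_swap]
    linarith
  refine isConvexPentagon_of_orient_pos h5
    ![pinwheelPoint k i (f 0),
      pinwheelPoint k i (f 1),
      pinwheelPoint k i (f 2),
      pinwheelPoint k (nextSpoke i) (g 1),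
      pinwheelPoint k (nextSpoke i) (g 0)] ?_
    (hpos (by decide) (by decide))
    (hnext (by decide) 1)
    (hnext (by decide) 0)
    (hnext (by decide) 1)
    (hnext (by decide) 0)
    (hback 0)
    (hnext (by decide) 1)
    (hback 1)
    (hback 2)
  intro a
  fin_cases a
  exacts [(hfP 0).2, (hfP 1).2, (hfP 2).2, (hgP 1).2, (hgP 0).2]

end Sufficiency

/-- The shape of the convex pentagons of the pinwheel: `5 - m` points in the spoke `i` and `m`
points in the next one. -/
theorem isConvexPentagon_iff_exists_card {k : ℕ} {P : Finset (ℝ × ℝ)} (hP : P ⊆ pinwheel k)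
    (h5 : P.card = 5) :
    IsConvexPentagon P ↔ ∃ i : Fin 4, ∃ m : Fin 3, (P ∩ pinwheelSpoke k i).card = 5 - m ∧
      (P ∩ pinwheelSpoke k (nextSpoke i)).card = m := by
  constructor
  · intro h
    have hthree : ∃ i, 3 ≤ (P ∩ pinwheelSpoke k i).card := by
      have hsum := card_eq_sum_inter hP 0
      have ha := h.inter_opposite_eq_zero_of_two (k := k) (i := 0)
      have hb := h.inter_opposite_eq_zero_of_two (k := k) (i := 2)
      have hc := h.inter_opposite_eq_zero_of_two (k := k) (i := 1)
      have hd := h.inter_opposite_eq_zero_of_two (k := k) (i := 3)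
      -- With at most two points per spoke, a spoke with two points and a nonempty successor would
      -- leave at most four points in all. So every spoke with two points has an empty successor,
      -- and then the counts cannot reach five.
      by_contra! hlt
      have h0 := hlt 0
      have h1 := hlt 1
      have h2 := hlt 2
      have h3 := hlt 3
      simp only [nextSpoke] at *
      omega
    obtain ⟨i, hi⟩ := hthree
    have hsum := card_eq_sum_inter hP i
    have hz := h.inter_opposite_eq_zero_of_three hi
    refine ⟨i, ⟨5 - (P ∩ pinwheelSpoke k i).card, by omega⟩, ?_, ?_⟩ <;> dsimp only <;> omega
  · rintro ⟨i, m, hm1, hm2⟩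
    fin_cases m
    · exact isConvexPentagon_of_five h5 hm1.ge
    · exact isConvexPentagon_of_four_one h5 hm1.ge hm2.ge
    · exact isConvexPentagon_of_three_two h5 hm1.ge hm2.ge

/-! ### Counting -/

/-- The unions of `5 - m` points of the spoke `i` and `m` points of the next one. -/
noncomputable def pentagonFamily (k : ℕ) (x : Fin 4 × Fin 3) : Finset (Finset (ℝ × ℝ)) :=
  ((pinwheelSpoke k x.1).powersetCard (5 - x.2) ×ˢ
    (pinwheelSpoke k (nextSpoke x.1)).powersetCard x.2).image fun A => A.1 ∪ A.2

theorem nextSpoke_ne (i : Fin 4) : nextSpoke i ≠ i := by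
  revert i
  decide

theorem union_inter_of_disjoint {α : Type*} [DecidableEq α] {A B S T : Finset α} (hA : A ⊆ S)
    (hB : B ⊆ T) (h : Disjoint S T) : (A ∪ B) ∩ S = A ∧ (A ∪ B) ∩ T = B := by
  rw [Finset.union_inter_distrib_right, Finset.union_inter_distrib_right,
    Finset.inter_eq_left.2 hA, Finset.inter_eq_left.2 hB,
    Finset.disjoint_iff_inter_eq_empty.1 (h.symm.mono_left hB),
    Finset.disjoint_iff_inter_eq_empty.1 (h.mono_left hA)]
  simp

theorem mem_pentagonFamily {k : ℕ} {x : Fin 4 × Fin 3} {P : Finset (ℝ × ℝ)} :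
    P ∈ pentagonFamily k x ↔ P ⊆ pinwheel k ∧ P.card = 5 ∧
      (P ∩ pinwheelSpoke k x.1).card = 5 - x.2 ∧
      (P ∩ pinwheelSpoke k (nextSpoke x.1)).card = x.2 := by
  have hdisj := disjoint_pinwheelSpoke k (nextSpoke_ne x.1).symm
  simp only [pentagonFamily, Finset.mem_image, Finset.mem_product, Finset.mem_powersetCard,
    Prod.exists]
  constructor
  · rintro ⟨A, B, ⟨⟨hA, hAc⟩, hB, hBc⟩, rfl⟩
    obtain ⟨h1, h2⟩ := union_inter_of_disjoint hA hB hdisj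
    refine ⟨Finset.union_subset (hA.trans (pinwheelSpoke_subset_pinwheel k _))
      (hB.trans (pinwheelSpoke_subset_pinwheel k _)), ?_, by rw [h1, hAc], by rw [h2, hBc]⟩
    rw [Finset.card_union_of_disjoint (hdisj.mono hA hB), hAc, hBc]
    omega
  · rintro ⟨hP, h5, h1, h2⟩
    refine ⟨_, _, ⟨⟨Finset.inter_subset_right, h1⟩, Finset.inter_subset_right, h2⟩, ?_⟩
    refine Finset.eq_of_subset_of_card_le
      (Finset.union_subset Finset.inter_subset_left Finset.inter_subset_left) ?_
    rw [Finset.card_union_of_disjoint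
      (hdisj.mono Finset.inter_subset_right Finset.inter_subset_right), h1, h2, h5]
    omega

theorem card_pentagonFamily (k : ℕ) (x : Fin 4 × Fin 3) :
    (pentagonFamily k x).card = k.choose (5 - x.2) * k.choose x.2 := by
  have hdisj := disjoint_pinwheelSpoke k (nextSpoke_ne x.1).symm
  rw [pentagonFamily, Finset.card_image_of_injOn, Finset.card_product, Finset.card_powersetCard,
    Finset.card_powersetCard, card_pinwheelSpoke, card_pinwheelSpoke]
  -- Injectivity: intersecting the union with the two disjoint spokes recovers both pieces.
  rintro ⟨A, B⟩ h ⟨A', B'⟩ h' heq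
  simp only [Finset.coe_product, Set.mem_prod, Finset.mem_coe, Finset.mem_powersetCard] at h h'
  dsimp only at heq
  obtain ⟨h1, h2⟩ := union_inter_of_disjoint h.1.1 h.2.1 hdisj
  obtain ⟨h1', h2'⟩ := union_inter_of_disjoint h'.1.1 h'.2.1 hdisj
  rw [heq] at h1 h2
  rw [← h1, ← h2, h1', h2']

/-- The leading spoke holds at least three of the five points, so it is unique; `m` is then the
count on its successor. -/
theorem disjoint_pentagonFamily (k : ℕ) {x y : Fin 4 × Fin 3} (hxy : x ≠ y) :
    Disjoint (pentagonFamily k x) (pentagonFamily k y) := by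
  rw [Finset.disjoint_left]
  intro P hx hy
  obtain ⟨-, h5, hx1, hx2⟩ := mem_pentagonFamily.1 hx
  obtain ⟨-, -, hy1, hy2⟩ := mem_pentagonFamily.1 hy
  have hi : x.1 = y.1 := by
    by_contra hne
    have hle := Finset.card_le_card (Finset.union_subset
      (Finset.inter_subset_left (s₁ := P) (s₂ := pinwheelSpoke k x.1))
      (Finset.inter_subset_left (s₁ := P) (s₂ := pinwheelSpoke k y.1)))
    rw [Finset.card_union_of_disjoint ((disjoint_pinwheelSpoke k hne).mono
      Finset.inter_subset_right Finset.inter_subset_right)] at hle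
    omega
  refine hxy (Prod.ext hi (Fin.ext ?_))
  rw [← hx2, ← hy2, hi]

theorem numConvexPentagons_pinwheel (k : ℕ) :
    numConvexPentagons (pinwheel k) = 2 * (2 * k).choose 5 := by
  classical
  have h : (pinwheel k).powerset.filter IsConvexPentagon =
      Finset.univ.biUnion (pentagonFamily k) := by
    ext P
    simp only [Finset.mem_filter, Finset.mem_powerset, Finset.mem_biUnion, Finset.mem_univ,
      true_and, mem_pentagonFamily, Prod.exists]
    constructor
    · rintro ⟨hP, hc⟩
      obtain ⟨i, m, him⟩ := (isConvexPentagon_iff_exists_card hP hc.1).1 hc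
      exact ⟨i, m, hP, hc.1, him⟩
    · rintro ⟨i, m, hP, h5, him⟩
      exact ⟨hP, (isConvexPentagon_iff_exists_card hP h5).2 ⟨i, m, him⟩⟩
  -- Vandermonde's identity for `k + k`, with the six terms paired by symmetry.
  have hvan : (2 * k).choose 5 =
      2 * (k.choose 5 + k.choose 4 * k.choose 1 + k.choose 3 * k.choose 2) := by
    rw [two_mul, Nat.add_choose_eq, Finset.Nat.sum_antidiagonal_eq_sum_range_succ_mk]
    simp only [Finset.sum_range_succ, Finset.sum_range_zero, Nat.choose_zero_right, Nat.reduceSub]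
    ring
  have hcard : numConvexPentagons (pinwheel k) =
      (Finset.univ.biUnion (pentagonFamily k)).card := by
    rw [← h, numConvexPentagons]
  rw [hcard, Finset.card_biUnion fun x _ y _ hxy => disjoint_pentagonFamily k hxy, hvan]
  simp only [card_pentagonFamily, Fintype.sum_prod_type, Fin.sum_univ_three, Fin.sum_univ_four,
    Fin.val_zero, Fin.val_one, Fin.val_two, Nat.choose_zero_right, Nat.reduceSub]
  ring

theorem mainTheorem5 (k : ℕ) :
    (pinwheel k).card = 4 * k ∧
    InGeneralPosition (pinwheel k) ∧
    (∀ P : Finset (ℝ × ℝ), P ⊆ pinwheel k → P.card = 5 →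
      (IsConvexPentagon P ↔
        ∃ i : Fin 4,
          P ⊆ pinwheelSpoke k i ∨
          ((P ∩ pinwheelSpoke k i).card = 4 ∧
            (P ∩ pinwheelSpoke k (nextSpoke i)).card = 1) ∨
          ((P ∩ pinwheelSpoke k i).card = 3 ∧
            (P ∩ pinwheelSpoke k (nextSpoke i)).card = 2))) ∧
    numConvexPentagons (pinwheel k) = 2 * (2 * k).choose 5 := by
  refine ⟨card_pinwheel k, inGeneralPosition_pinwheel k, fun P hP h5 => ?_,
    numConvexPentagons_pinwheel k⟩
  rw [isConvexPentagon_iff_exists_card hP h5]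
  refine exists_congr fun i => ?_
  -- Containment in one spoke is the case `m = 0` of `isConvexPentagon_iff_exists_card`.
  have hsub : P ⊆ pinwheelSpoke k i ↔ (P ∩ pinwheelSpoke k i).card = 5 ∧
      (P ∩ pinwheelSpoke k (nextSpoke i)).card = 0 := by
    have hsum := card_eq_sum_inter hP i
    constructor
    · intro h
      rw [Finset.inter_eq_left.2 h, h5] at hsum ⊢
      omega
    · rintro ⟨h, -⟩
      rw [← Finset.inter_eq_left]
      exact Finset.eq_of_subset_of_card_le Finset.inter_subset_left (by omega)
  rw [hsub, Fin.exists_fin_succ, Fin.exists_fin_two]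
  simp
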